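/- Let $F/K$ be a finite Galois extension of number fields, $\mathcal{O}_F$ the ring of integers of $F$, and $\mathfrak{P}$ a nonzero prime ideal of $\mathcal{O}_F$. For real $x\ge -1$ let $$D_x(F/K,\mathfrak{P})=\{\sigma\in\mathrm{Gal}(F/K) : \sigma\mathfrak{P}=\mathfrak{P},\ v_{\mathfrak{P}}(\sigma\alpha-\alpha)\ge x+1 \text{ for all } \alpha\in\mathcal{O}_F\}$$ and put $g_i=|D_i(F/K,\mathfrak{P})|$ for integers $i\ge 0$. Let $\varphi:[-1,\infty)\to[-1,\infty)$ be the increasing bijection given by $\varphi(u)=u$ for $-1\le u\le 0$ and $\varphi(u)=\frac{1}{g_0}\bigl(g_1+\cdots+g_m+(u-m)g_{m+1}\bigr)$, $m=\lfloor u\rfloor$, for $u\ge 0$; let $\psi$ be its inverse. The upper ramification groups are $D^y(F/K,\mathfrak{P})=D_{\psi(y)}(F/K,\mathfrak{P})$ for real $y\ge -1$. For a possibly infinite Galois extension $L/K$ of a number field $K$ and a prime ideal $\mathfrak{P}$ of the ring $\mathcal{O}_L$ of algebraic integers of $L$, lying above a nonzero prime ideal $\mathfrak{p}$ of $\mathcal{O}_K$,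 let $$D^y(L/K,\mathfrak{P})=\{\sigma\in\mathrm{Gal}(L/K) : \sigma|_F\in D^y(F/K,\mathfrak{P}\cap F) \text{ for all finite Galois } F/K \text{ with } F\subseteq L\}.$$ Up to conjugation in $\mathrm{Gal}(L/K)$ this depends only on $\mathfrak{p}$ and $y$. We say that $L/K$ is deeply ramified at $\mathfrak{p}$ if $D^y(L/K,\mathfrak{P})$ is nontrivial for every real $y\ge -1$, for one (equivalently, every) prime $\mathfrak{P}$ of $L$ above $\mathfrak{p}$. **Theorem 4.4.** Let $K$ be a number field and let $L/K$ be a (finite or infinite) Galois extension that is deeply ramified at some nonzero prime ideal $\mathfrak{p}$ of $\mathcal{O}_K$. Then $L/K$ is asymptotically bad: there is a sequence $(F_n)_{n\ge 0}$ of finite subextensions of $L/K$ whose root discriminants $$\mathrm{rd}_{F_n}=|\mathrm{disc}_{F_n}|^{1/[F_n:\mathbb{Q}]}$$ tend to infinity as $n\to\infty$. -/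

import Mathlib

open scoped NumberField Pointwise
open Filter

namespace HigherRamification

noncomputable section

/-! ### Finite layers

In the following definitions `F/K` is an extension of fields and `P` an ideal of `𝓞 F`; they are
used for a finite Galois extension `F/K` of number fields and a nonzero prime `P` of `𝓞 F`. -/

section Finite

variable (K : Type*) {F : Type*} [Field K] [Field F] [Algebra K F]

/-- The ramification group `D_x(F/K, P)` of index `x ≥ -1` in the lower numbering: the `σ` in the
decomposition group of `P` (the stabilizer of `P` in `Gal(F/K)`) such that
`v_P (σ α - α) ≥ x + 1`, that is, `σ α - α ∈ P ^ ⌈x + 1⌉`, for all `α ∈ 𝓞 F`. -/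
def lowerGroup (P : Ideal (𝓞 F)) (x : ℝ) : Subgroup Gal(F/K) :=
  MulAction.stabilizer Gal(F/K) P ⊓ (P ^ ⌈x + 1⌉₊).inertia Gal(F/K)

/-- The order `g_i` of `D_i(F/K, P)`. -/
def lowerCard (P : Ideal (𝓞 F)) (i : ℕ) : ℝ :=
  (Nat.card (lowerGroup K P (i : ℝ)) : ℝ)

/-- The Herbrand function: `φ(u) = u` for `-1 ≤ u ≤ 0`, and
`φ(u) = (g_1 + ⋯ + g_m + (u - m) g_{m+1}) / g_0` with `m = ⌊u⌋` for `u ≥ 0`. -/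
def herbrandPhi (P : Ideal (𝓞 F)) (u : ℝ) : ℝ :=
  if u ≤ 0 then u
  else ((∑ i ∈ Finset.Icc 1 ⌊u⌋₊, lowerCard K P i)
    + (u - (⌊u⌋₊ : ℝ)) * lowerCard K P (⌊u⌋₊ + 1)) / lowerCard K P 0

/-- The function `ψ : [-1, ∞) → [-1, ∞)` inverse to the Herbrand function. -/
def herbrandPsi (P : Ideal (𝓞 F)) : ℝ → ℝ :=
  Function.invFunOn (herbrandPhi K P) (Set.Ici (-1))

/-- The ramification group `D^y(F/K, P) = D_{ψ(y)}(F/K, P)` of index `y ≥ -1` in the upper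
numbering. -/
def upperGroup (P : Ideal (𝓞 F)) (y : ℝ) : Subgroup Gal(F/K) :=
  lowerGroup K P (herbrandPsi K P y)

end Finite

/-! ### Possibly infinite Galois extensions -/

section Profinite

variable (K : Type*) {L : Type*} [Field K] [Field L] [Algebra K L]

/-- The ramification group `D^y(L/K, P)` in the upper numbering of a possibly infinite Galois
extension `L/K`: the inverse limit, inside `Gal(L/K) = lim Gal(F/K)`, of the groups
`D^y(F/K, P ∩ F)`, over all finite Galois subextensions `F/K` of `L/K`. -/
def profiniteUpperGroup (P : Ideal (𝓞 L)) [Normal K L] (y : ℝ) : Subgroup Gal(L/K) :=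
  ⨅ F : FiniteGaloisIntermediateField K L,
    (upperGroup K (P.under (𝓞 F)) y).comap (AlgEquiv.restrictNormalHom F)

variable (L)

/-- `L/K` is deeply ramified at `p`: the upper ramification groups at `p` of all indices `y ≥ -1`
are nontrivial. These groups are taken at a prime `P` of `L` above `p`; another choice of `P`
replaces them by conjugate subgroups of `Gal(L/K)`. -/
def IsDeeplyRamifiedAt [Normal K L] (p : Ideal (𝓞 K)) : Prop :=
  ∃ P : Ideal (𝓞 L), P.IsPrime ∧ P.LiesOver p ∧
    ∀ y : ℝ, -1 ≤ y → profiniteUpperGroup K P y ≠ ⊥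

/-- `L/K` is asymptotically bad: the root discriminant `|disc_F| ^ (1 / [F : ℚ])` tends to infinity
along some sequence of finite subextensions `F/K` of `L/K`. -/
def IsAsymptoticallyBad [NumberField K] : Prop :=
  ∃ (F : ℕ → IntermediateField K L) (hF : ∀ n, FiniteDimensional K (F n)),
    Tendsto
      (fun n ↦
        haveI := hF n
        haveI : NumberField (F n) := NumberField.of_module_finite K (F n)
        NumberField.rootDiscr (F n))
      atTop atTop

end Profinite

end

end HigherRamification

/-!
If `D^y(L/K)` is nontrivial, then so is `D^y(F/K)` for some finite Galois layer `F/K`, directly from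
the definition of `D^y(L/K)` by restriction to the finite layers
(`exists_upperGroup_ne_bot`). It therefore suffices to bound the root discriminant of a finite Galois
extension `F/K` from below when `D^y(F/K)` is nontrivial at a prime `P` above `p`
(`le_log_rootDiscr`).

Let `u = ψ(y)`. All `g_i` with `i ≤ ⌈u⌉` are at least `2`, and `φ(u) = y` gives
`y g_0 ≤ g_1 + ⋯ + g_{⌈u⌉} ≤ 2 d` with `d = ∑_{i ≤ ⌈u⌉} (g_i - 1)` (`mul_lowerCard_zero_le`). On the
other hand `P ^ d` divides the different of `F/K` (`pow_differentBound_dvd_differentIdeal`). This is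
one half of Hilbert's formula for the different; it rests on the existence of an `x` that generates
`𝓞 F` over `𝓞 K` locally at `P` (`exists_not_conductor_le`), since then the different has the same
exponent at `P` as `∏_{σ ≠ 1} (x - σ x)`.

The same bound holds at all conjugates of `P`, and `g_0` is the ramification index, so `p ^ d` divides
the `g_0`-th power of the different. Taking norms, `|disc F|` is at least
`N(p) ^ ([F : K] d / g_0) ≥ N(p) ^ ([F : K] y / 2)`, and the root discriminant of `F` is at least
`N(p) ^ (y / (2 [K : ℚ]))`, which is unbounded as `y` grows.
-/

/-! ### Generators at a prime -/

/-- A prime `P` with finite residue field has an element `b` which generates the multiplicative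
group of the residue field and for which `b ^ q - b` is a uniformizer at `P`, where `q = |S ⧸ P|`.
Given one lift `b₀` of a generator and a uniformizer `π`, one of `b₀` and `b₀ + π` will do: since
the derivative of `X ^ q - X` is `-1` modulo `P`, the two values differ by `-π` modulo `P ^ 2`. -/
theorem exists_generator_residue_and_uniformizer {S : Type*} [CommRing S] [IsDedekindDomain S]
    (P : Ideal S) [P.IsPrime] (hP : P ≠ ⊥) [Finite (S ⧸ P)] :
    ∃ (b : S) (q : ℕ), 1 < q ∧ b ∉ P ∧ (∀ s : S, s ∈ P ∨ ∃ k : ℕ, s - b ^ k ∈ P) ∧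
      b ^ q - b ∈ P ∧ b ^ q - b ∉ P ^ 2 := by
  have hmax : P.IsMaximal := Ideal.IsPrime.isMaximal ‹_› hP
  let : Field (S ⧸ P) := Ideal.Quotient.field P
  let : Fintype (S ⧸ P) := Fintype.ofFinite _
  obtain ⟨g, hg⟩ := IsCyclic.exists_monoid_generator (α := (S ⧸ P)ˣ)
  obtain ⟨b₀, hb₀⟩ := Ideal.Quotient.mk_surjective (g : S ⧸ P)
  have hgen : ∀ b : S, Ideal.Quotient.mk P b = g →
      b ∉ P ∧ (∀ s : S, s ∈ P ∨ ∃ k : ℕ, s - b ^ k ∈ P) ∧ b ^ Fintype.card (S ⧸ P) - b ∈ P := by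
    intro b hb
    refine ⟨fun h ↦ g.ne_zero (hb ▸ Ideal.Quotient.eq_zero_iff_mem.2 h), fun s ↦ ?_, ?_⟩
    · by_cases hs : s ∈ P
      · exact .inl hs
      right
      have hs' : Ideal.Quotient.mk P s ≠ 0 := fun h ↦ hs (Ideal.Quotient.eq_zero_iff_mem.1 h)
      obtain ⟨k, hk⟩ := (Submonoid.mem_powers_iff _ _).1 (hg (Units.mk0 _ hs'))
      refine ⟨k, Ideal.Quotient.eq_zero_iff_mem.1 ?_⟩
      have := congrArg (Units.val) hk
      simp only [Units.val_pow_eq_pow_val, Units.val_mk0] at this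
      rw [map_sub, map_pow, hb, this, sub_self]
    · rw [← Ideal.Quotient.eq_zero_iff_mem, map_sub, map_pow, FiniteField.pow_card, sub_self]
  have hq : 1 < Fintype.card (S ⧸ P) := Fintype.one_lt_card
  have hqP : ((Fintype.card (S ⧸ P) : ℕ) : S) ∈ P := by
    rw [← Ideal.Quotient.eq_zero_iff_mem, map_natCast, Nat.cast_card_eq_zero]
  obtain ⟨π, hπ, hπ2⟩ := SetLike.exists_of_lt
    (Ideal.pow_right_strictAnti P hP hmax.ne_top (show 1 < 2 by norm_num))
  replace hπ : π ∈ P := by simpa using hπ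
  replace hπ2 : π ∉ P ^ 2 := hπ2
  set q := Fintype.card (S ⧸ P)
  by_cases h : b₀ ^ q - b₀ ∈ P ^ 2
  · have hb : Ideal.Quotient.mk P (b₀ + π) = g := by
      rw [map_add, hb₀, Ideal.Quotient.eq_zero_iff_mem.2 hπ, add_zero]
    obtain ⟨h1, h2, h3⟩ := hgen _ hb
    refine ⟨b₀ + π, q, hq, h1, h2, h3, fun h4 ↦ hπ2 ?_⟩
    obtain ⟨k, hk⟩ := Polynomial.powAddExpansion b₀ π q
    have h5 : (q : S) * b₀ ^ (q - 1) * π ∈ P ^ 2 := by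
      rw [pow_two]
      exact Ideal.mul_mem_mul (Ideal.mul_mem_right _ _ hqP) hπ
    have h6 : k * π ^ 2 ∈ P ^ 2 := Ideal.mul_mem_left _ _ (Ideal.pow_mem_pow hπ 2)
    have : π = (b₀ ^ q - b₀) + (q : S) * b₀ ^ (q - 1) * π + k * π ^ 2
        - ((b₀ + π) ^ q - (b₀ + π)) := by rw [hk]; ring
    rw [this]
    exact sub_mem (add_mem (add_mem h h5) h6) h4
  · obtain ⟨h1, h2, h3⟩ := hgen _ hb₀
    exact ⟨b₀, q, hq, h1, h2, h3, h⟩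

/-- Local monogenicity: some order `R[x]` agrees with `S` at `P`, that is, its conductor is prime to
`P`. The element `x` is chosen congruent modulo `P ^ 2` to an element generating the residue field
and providing a uniformizer, and inside all other primes `Q` of `S` above `P ∩ R`. Then
`m = P ∩ R[x]` satisfies `m S = P` and `R[x] + P = S`, so Nakayama's lemma for the `R[x]`-module
`S` produces an element of `R[x]`, congruent to `1` modulo `m`, that multiplies `S` into `R[x]`. -/
theorem exists_not_conductor_le (R : Type*) {S : Type*} [CommRing R] [IsDomain R] [CommRing S]
    [IsDedekindDomain S] [Algebra R S] [FaithfulSMul R S] [Module.Finite R S]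
    (P : Ideal S) [P.IsPrime] (hP : P ≠ ⊥) [Finite (S ⧸ P)] :
    ∃ x : S, ¬ conductor R x ≤ P := by
  have hmax : P.IsMaximal := Ideal.IsPrime.isMaximal ‹_› hP
  have hPp : Prime P := Ideal.prime_of_isPrime hP ‹_›
  obtain ⟨b, q, hq, hbP, hgen, hbq, hbq2⟩ := exists_generator_residue_and_uniformizer P hP
  have hp : (P.under R).map (algebraMap R S) ≠ ⊥ :=
    Ideal.map_ne_bot_of_ne_bot (Ideal.under_ne_bot R hP)
  -- `J` is the prime-to-`P` part of `p S`, so every prime above `p` other than `P` contains `J`.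
  obtain ⟨J, hpJ, hJ⟩ := (FiniteMultiplicity.of_prime_left hPp hp).exists_eq_pow_mul_and_not_dvd
  have hcop : IsCoprime (P ^ 2) J := by
    refine IsCoprime.pow_left ?_
    rw [Ideal.isCoprime_iff_sup_eq]
    exact hmax.out.2 _ (left_lt_sup.2 fun h ↦ hJ (Ideal.dvd_iff_le.2 h))
  obtain ⟨u, hu, v, hv, huv⟩ := Ideal.isCoprime_iff_exists.1 hcop
  have hxJ : b * v ∈ J := Ideal.mul_mem_left _ _ hv
  have hxb2 : b * v - b ∈ P ^ 2 := by
    have : b * v - b = -b * u := by linear_combination b * huv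
    rw [this]
    exact Ideal.mul_mem_left _ _ hu
  set x := b * v
  have hxb : x - b ∈ P := Ideal.pow_le_self two_ne_zero hxb2
  have hpow (I : Ideal S) (h : x - b ∈ I) (k : ℕ) : x ^ k - b ^ k ∈ I :=
    Ideal.mem_of_dvd I (sub_dvd_pow_sub_pow x b k) h
  have hxq (I : Ideal S) (h : x - b ∈ I) : x ^ q - x ∈ I ↔ b ^ q - b ∈ I := by
    have h1 : (x ^ q - x) - (b ^ q - b) ∈ I := by
      convert sub_mem (hpow I h q) h using 1
      ring
    exact ⟨fun h2 ↦ by simpa using sub_mem h2 h1, fun h2 ↦ by simpa using add_mem h1 h2⟩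
  have hxP : x ∉ P := fun h ↦ hbP (by simpa using sub_mem h hxb)
  refine ⟨x, ?_⟩
  let A := Algebra.adjoin R {x}
  have hxA : x ∈ A := Algebra.self_mem_adjoin_singleton R x
  let m : Ideal A := P.under A
  have hmem (a : A) (ha : (a : S) ∈ P) : (a : S) ∈ m.map (algebraMap A S) :=
    Ideal.mem_map_of_mem (algebraMap A S) (show a ∈ m from ha)
  have hmP : m.map (algebraMap A S) ≤ P := Ideal.map_comap_le
  have hxm : x ^ q - x ∈ m.map (algebraMap A S) :=
    hmem ⟨x ^ q - x, sub_mem (pow_mem hxA q) hxA⟩ ((hxq P hxb).2 hbq)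
  have hpm : (P.under R).map (algebraMap R S) ≤ m.map (algebraMap A S) := by
    rw [Ideal.map_le_iff_le_comap]
    intro r hr
    exact hmem (algebraMap R A r) hr
  -- Another prime `Q` containing `m` would contain `x`, and also `x ^ (q - 1) - 1 ∈ m`.
  have huniq (Q : Ideal S) (hQ : Q.IsMaximal) (hmQ : m.map (algebraMap A S) ≤ Q) : Q = P := by
    by_contra hQP
    have hPQ : ¬ P ≤ Q := fun h ↦ hQP (hmax.eq_of_le hQ.ne_top h).symm
    have hJQ : J ≤ Q := by
      have h1 : P ^ _ * J ≤ Q := hpJ ▸ hpm.trans hmQ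
      exact (hQ.isPrime.mul_le.1 h1).resolve_left fun h ↦ hPQ (hQ.isPrime.le_of_pow_le h)
    have hxQ : x ∈ Q := hJQ hxJ
    have h1 : x ^ (q - 1) - 1 ∈ P := by
      have h2 : x * (x ^ (q - 1) - 1) ∈ P := by
        rw [mul_sub, mul_one, mul_pow_sub_one (by omega)]
        exact (hxq P hxb).2 hbq
      exact (Ideal.IsPrime.mem_or_mem ‹_› h2).resolve_left hxP
    have h2 : x ^ (q - 1) - 1 ∈ Q :=
      hmQ (hmem ⟨x ^ (q - 1) - 1, sub_mem (pow_mem hxA _) (one_mem _)⟩ h1)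
    have h3 : x ^ (q - 1) ∈ Q := Ideal.pow_mem_of_mem _ hxQ _ (by omega)
    exact hQ.ne_top ((Ideal.eq_top_iff_one _).2 (by simpa using sub_mem h3 h2))
  -- `P` is the only prime dividing `m S`, and it divides it once because of `x ^ q - x`.
  have hmP' : m.map (algebraMap A S) = P := by
    obtain ⟨I, hI⟩ := Ideal.dvd_iff_le.2 hmP
    by_cases hItop : I = ⊤
    · rw [hI, hItop, Ideal.mul_top]
    obtain ⟨Q, hQ, hIQ⟩ := Ideal.exists_le_maximal I hItop
    have hQP := huniq Q hQ (hI ▸ Ideal.mul_le_right.trans hIQ)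
    have h1 : m.map (algebraMap A S) ≤ P ^ 2 := by
      rw [hI, pow_two]
      exact Ideal.mul_mono le_rfl (hQP ▸ hIQ)
    exact absurd ((hxq _ hxb2).1 (h1 hxm)) hbq2
  have : Module.Finite A S := Module.Finite.of_restrictScalars_finite R A S
  have hsup : (⊤ : Submodule A S) ≤ LinearMap.range (Algebra.linearMap A S) ⊔ m • ⊤ := by
    intro s _
    rw [Ideal.smul_top_eq_map, hmP']
    rcases hgen s with hs | ⟨k, hk⟩
    · exact Submodule.mem_sup_right hs
    · refine Submodule.mem_sup.2 ⟨x ^ k, ⟨⟨x ^ k, pow_mem hxA k⟩, rfl⟩, s - x ^ k, ?_, by ring⟩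
      have : s - x ^ k = (s - b ^ k) - (x ^ k - b ^ k) := by ring
      rw [this]
      exact sub_mem hk (hpow P hxb k)
  obtain ⟨r, hr, hrS⟩ := Submodule.exists_sub_one_mem_and_smul_le_of_fg_of_le_sup
    (Module.finite_def.1 this) le_rfl hsup
  intro hle
  have hrc : (r : S) ∈ conductor R x := by
    intro s
    obtain ⟨a, ha⟩ := hrS (Submodule.smul_mem_pointwise_smul s r ⊤ trivial)
    have : (r : S) * s = a := ha.symm
    rw [this]
    exact a.2
  have h1 : (r : S) - 1 ∈ P := hr
  exact hmax.ne_top ((Ideal.eq_top_iff_one _).2 (by simpa using sub_mem (hle hrc) h1))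

/-! ### Derivatives and primitive elements -/

open Polynomial in
/-- If the conjugates `σ x` are distinct, then `∏ (X - σ x)` divides any polynomial `f` over `A` that
vanishes at `x`; differentiating the factorization at `x` leaves the factors with `σ ≠ 1`. -/
theorem prod_sub_smul_dvd_aeval_derivative {A B G : Type*} [CommRing A] [CommRing B] [IsDomain B]
    [Algebra A B] [Group G] [Fintype G] [DecidableEq G] [MulSemiringAction G B]
    [SMulCommClass G A B] {f : A[X]} (hf : f ≠ 0) [FaithfulSMul A B] {x : B} (hx : aeval x f = 0)
    (hinj : Function.Injective fun σ : G ↦ σ • x) :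
    ∏ σ ∈ Finset.univ.erase (1 : G), (x - σ • x) ∣ aeval x (derivative f) := by
  have hroot (σ : G) : aeval (σ • x) f = 0 := by
    have := congrArg (MulSemiringAction.toAlgHom A B σ) hx
    rw [← aeval_algHom_apply] at this
    simpa using this
  have hf' : f.map (algebraMap A B) ≠ 0 :=
    (Polynomial.map_ne_zero_iff (FaithfulSMul.algebraMap_injective A B)).2 hf
  have hdvd : ∏ σ : G, (X - C (σ • x)) ∣ f.map (algebraMap A B) := by
    have h := (Multiset.prod_X_sub_C_dvd_iff_le_roots hf'
      (Finset.univ.val.map fun σ : G ↦ σ • x)).2 <| by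
        refine (Multiset.le_iff_subset (Finset.univ.nodup.map hinj)).2 fun y hy ↦ ?_
        obtain ⟨σ, -, rfl⟩ := Multiset.mem_map.1 hy
        rw [mem_roots hf', IsRoot.def, eval_map_algebraMap, hroot]
    simpa using h
  obtain ⟨h, hh⟩ := hdvd
  rw [← Finset.mul_prod_erase _ _ (Finset.mem_univ (1 : G)), one_smul, mul_assoc] at hh
  have : aeval x (derivative f) = eval x (derivative (f.map (algebraMap A B))) := by
    rw [derivative_map, eval_map_algebraMap]
  rw [this, hh]
  simp [eval_prod]

theorem adjoin_eq_top_of_conductor_ne_bot {K F : Type*} [Field K] [Field F] [NumberField F]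
    [Algebra K F] [Algebra.IsAlgebraic K F] {x : 𝓞 F} (hx : conductor (𝓞 K) x ≠ ⊥) :
    Algebra.adjoin K {(x : F)} = ⊤ := by
  obtain ⟨s, hs, hs0⟩ := Submodule.exists_mem_ne_zero_of_ne_bot hx
  have hint : IsIntegral K (x : F) := Algebra.IsIntegral.isIntegral _
  have hadj (y : 𝓞 F) : algebraMap (𝓞 F) F (s * y) ∈ IntermediateField.adjoin K {(x : F)} := by
    have h1 : s * y ∈ Algebra.adjoin (𝓞 K) {x} := hs y
    generalize s * y = t at h1
    induction h1 using Algebra.adjoin_induction with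
    | mem z hz => 
      rw [Set.mem_singleton_iff.1 hz]
      exact IntermediateField.mem_adjoin_simple_self K _
    | algebraMap r =>
      have := (IntermediateField.adjoin K {(x : F)}).algebraMap_mem (r : K)
      rwa [← IsScalarTower.algebraMap_apply (𝓞 K) K F,
        IsScalarTower.algebraMap_apply (𝓞 K) (𝓞 F) F] at this
    | add a b _ _ ha hb => simpa using add_mem ha hb
    | mul a b _ _ ha hb => simpa using mul_mem ha hb
  rw [← IntermediateField.adjoin_simple_toSubalgebra_of_isAlgebraic hint.isAlgebraic, eq_top_iff]
  intro z _
  obtain ⟨a, b, hb, rfl⟩ := IsFractionRing.div_surjective (A := 𝓞 F) z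
  have hs' : algebraMap (𝓞 F) F s ≠ 0 := by simpa using hs0
  have : (algebraMap (𝓞 F) F a) / algebraMap (𝓞 F) F b
      = algebraMap (𝓞 F) F (s * a) / algebraMap (𝓞 F) F (s * b) := by
    rw [map_mul, map_mul, mul_div_mul_left _ _ hs']
  rw [this]
  exact (IntermediateField.adjoin K {(x : F)}).div_mem (hadj a) (hadj b)

namespace HigherRamification

/-! ### Ramification groups and the different -/

section

variable {K F : Type*} [Field K] [Field F] [Algebra K F]

theorem lowerGroup_natCast (P : Ideal (𝓞 F)) (i : ℕ) :
    lowerGroup K P i = MulAction.stabilizer Gal(F/K) P ⊓ (P ^ (i + 1)).inertia Gal(F/K) := by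
  have : ⌈(i : ℝ) + 1⌉₊ = i + 1 := by exact_mod_cast Nat.ceil_natCast (R := ℝ) (i + 1)
  rw [lowerGroup, this]

theorem lowerGroup_antitone (P : Ideal (𝓞 F)) : Antitone (lowerGroup K P) := by
  intro x y hxy
  refine inf_le_inf_left _ fun σ hσ a ↦ Ideal.pow_le_pow_right (Nat.ceil_mono (by linarith)) (hσ a)

open Classical in
/-- An element `σ` of exactly `c` of the groups `D_0, …, D_{M-1}` lies in `D_{c-1}`, the groups being
nested. -/
theorem sub_smul_mem_pow (P : Ideal (𝓞 F)) (M : ℕ) (σ : Gal(F/K)) (x : 𝓞 F) :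
    x - σ • x ∈ P ^ ((Finset.range M).filter fun i : ℕ ↦ σ ∈ lowerGroup K P i).card := by
  set s := (Finset.range M).filter fun i : ℕ ↦ σ ∈ lowerGroup K P i
  rcases Nat.eq_zero_or_pos s.card with h | h
  · simp [h]
  obtain ⟨i, hi, hsi⟩ : ∃ i ∈ s, s.card ≤ i + 1 := by
    by_contra! hcon
    have : s ⊆ Finset.range (s.card - 1) := fun i hi ↦ by
      have := hcon i hi
      simp only [Finset.mem_range]
      omega
    have := Finset.card_le_card this
    simp at this
    omega
  have h1 := (Finset.mem_filter.1 hi).2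
  rw [lowerGroup_natCast] at h1
  exact Ideal.pow_le_pow_right hsi (sub_mem_comm_iff.1 (h1.2 x))

/-- The sum `∑_{i < M} (g_i - 1)`. For `M` large this is the exponent of `P` in the different of
`F/K` by Hilbert's formula; the partial sums are lower bounds for that exponent. -/
noncomputable def differentBound (K : Type*) {F : Type*} [Field K] [Field F] [Algebra K F]
    (P : Ideal (𝓞 F)) (M : ℕ) : ℕ :=
  ∑ i ∈ Finset.range M, (Nat.card (lowerGroup K P i) - 1)

theorem card_lowerGroup_smul (P : Ideal (𝓞 F)) (σ : Gal(F/K)) (x : ℝ) :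
    Nat.card (lowerGroup K (σ • P) x) = Nat.card (lowerGroup K P x) := by
  have key (σ : Gal(F/K)) (P : Ideal (𝓞 F)) (τ) (h : τ ∈ lowerGroup K P x) :
      σ * τ * σ⁻¹ ∈ lowerGroup K (σ • P) x := by
    refine ⟨?_, fun a ↦ ?_⟩
    · have : τ • P = P := h.1
      simp [MulAction.mem_stabilizer_iff, mul_smul, this]
    · have h1 := h.2 (σ⁻¹ • a)
      have h2 := Ideal.smul_mem_pointwise_smul σ _ _ h1
      have h3 : σ • P ^ ⌈x + 1⌉₊ = (σ • P) ^ ⌈x + 1⌉₊ := smul_pow' _ _ _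
      rw [h3] at h2
      simpa [smul_sub, mul_smul] using h2
  refine Nat.card_congr
    { toFun := fun τ ↦ ⟨σ⁻¹ * τ * σ, by simpa using key σ⁻¹ (σ • P) τ τ.2⟩
      invFun := fun τ ↦ ⟨σ * τ * σ⁻¹, key σ P τ τ.2⟩
      left_inv := fun τ ↦ by ext1; simp [mul_assoc]
      right_inv := fun τ ↦ by ext1; simp [mul_assoc] }

variable [NumberField K] [NumberField F] [IsGalois K F]

/-- The lower bound in Hilbert's formula for the exponent of the different. With `x` generating
`𝓞 F` over `𝓞 K` locally at `P`, the different agrees at `P` with the value at `x` of the derivative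
of the minimal polynomial, hence with `∏_{σ ≠ 1} (x - σ x)`. -/
theorem pow_differentBound_dvd_differentIdeal (P : Ideal (𝓞 F)) [P.IsPrime] (hP : P ≠ ⊥) (M : ℕ) :
    P ^ differentBound K P M ∣ differentIdeal (𝓞 K) (𝓞 F) := by
  classical
  have : FiniteDimensional K F := Module.Finite.of_restrictScalars_finite ℚ K F
  have : Finite (𝓞 F ⧸ P) := Ideal.finiteQuotientOfFreeOfNeBot P hP
  obtain ⟨x, hx⟩ := exists_not_conductor_le (𝓞 K) P hP
  have hadj : Algebra.adjoin K {algebraMap (𝓞 F) F x} = ⊤ :=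
    adjoin_eq_top_of_conductor_ne_bot fun h ↦ hx (h ▸ bot_le)
  have hprod := conductor_mul_differentIdeal (𝓞 K) K F x hadj
  have hinj : Function.Injective fun σ : Gal(F/K) ↦ σ • x := by
    intro σ τ h
    refine AlgEquiv.coe_toAlgHom_injective (AlgHom.ext_of_adjoin_eq_top hadj ?_)
    intro y hy
    rw [Set.mem_singleton_iff.1 hy]
    exact congrArg (algebraMap (𝓞 F) F) h
  have hdvd := prod_sub_smul_dvd_aeval_derivative (G := Gal(F/K))
    (minpoly.ne_zero (Algebra.IsIntegral.isIntegral (R := 𝓞 K) x)) (minpoly.aeval (𝓞 K) x) hinj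
  have hmem : ∏ σ ∈ Finset.univ.erase (1 : Gal(F/K)), (x - σ • x) ∈ P ^ differentBound K P M := by
    have h1 := Ideal.prod_mem_prod (s := Finset.univ.erase (1 : Gal(F/K)))
      (fun σ _ ↦ sub_smul_mem_pow P M σ x)
    rw [Finset.prod_pow_eq_pow_sum] at h1
    -- Both sides count the pairs `(i, σ)` with `i < M` and `1 ≠ σ ∈ D_i`.
    have h2 : differentBound K P M = ∑ σ ∈ Finset.univ.erase (1 : Gal(F/K)),
        ((Finset.range M).filter fun i : ℕ ↦ σ ∈ lowerGroup K P i).card := by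
      simp_rw [Finset.card_filter, differentBound]
      rw [Finset.sum_comm]
      refine Finset.sum_congr rfl fun i _ ↦ ?_
      rw [← Finset.card_filter, Nat.card_eq_fintype_card, Fintype.card_subtype,
        Finset.filter_erase, Finset.card_erase_of_mem]
      simp [one_mem]
    rwa [h2]
  refine (Ideal.prime_of_isPrime hP ‹_›).pow_dvd_of_dvd_mul_left _
    (fun h ↦ hx (Ideal.dvd_iff_le.1 h)) ?_
  rw [hprod, Ideal.dvd_span_singleton]
  exact Ideal.mem_of_dvd _ hdvd hmem

/-- With `d = ∑_{i < M} (g_i - 1)`, the power `Q ^ d` divides the different for each of the conjugate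
primes `Q` above `p`. As `p 𝓞_F = ∏ Q ^ e` with `e = g_0`, it follows that `p ^ d` divides the
`g_0`-th power of the different. -/
theorem map_pow_dvd_differentIdeal_pow (p : Ideal (𝓞 K)) [p.IsPrime] (hp : p ≠ ⊥)
    (P : Ideal (𝓞 F)) [P.IsPrime] [P.LiesOver p] (M : ℕ) :
    p.map (algebraMap (𝓞 K) (𝓞 F)) ^ differentBound K P M ∣
      differentIdeal (𝓞 K) (𝓞 F) ^ Nat.card (lowerGroup K P 0) := by
  classical
  have : FiniteDimensional K F := Module.Finite.of_restrictScalars_finite ℚ K F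
  have hpm : p.IsMaximal := Ideal.IsPrime.isMaximal ‹_› hp
  have : Finite (𝓞 K ⧸ p) := Ideal.finiteQuotientOfFreeOfNeBot p hp
  have he : Nat.card (lowerGroup K P 0) = p.ramificationIdxIn (𝓞 F) := by
    rw [← Ideal.card_inertia_eq_ramificationIdxIn (G := Gal(F/K)) p P]
    have := lowerGroup_natCast (K := K) P 0
    rw [Nat.cast_zero, zero_add, pow_one, inf_eq_right.2 (Ideal.inertia_le_stabilizer P)] at this
    rw [this]
  rw [Ideal.map_algebraMap_eq_finsetProd_pow hp, ← Finset.prod_pow]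
  have hidx : ∀ Q ∈ (p.primesOver (𝓞 F)).toFinset, (Q ^ Q.ramificationIdx (𝓞 K)) ^
      differentBound K P M = (Q ^ differentBound K P M) ^ Nat.card (lowerGroup K P 0) := by
    intro Q hQ
    obtain ⟨_, _⟩ := Set.mem_toFinset.1 hQ
    rw [he, Ideal.ramificationIdxIn_eq_ramificationIdx p Q Gal(F/K), pow_right_comm]
  rw [Finset.prod_congr rfl hidx, Finset.prod_pow]
  refine pow_dvd_pow_of_dvd (Finset.prod_dvd_of_coprime ?_ ?_) _
  · intro Q hQ Q' hQ' hne
    obtain ⟨_, _⟩ := Set.mem_toFinset.1 hQ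
    obtain ⟨_, _⟩ := Set.mem_toFinset.1 hQ'
    have h1 : Q.IsMaximal := Ideal.IsMaximal.of_liesOver_isMaximal Q p
    have h2 : Q'.IsMaximal := Ideal.IsMaximal.of_liesOver_isMaximal Q' p
    exact IsCoprime.pow (Ideal.isCoprime_of_isMaximal hne)
  · intro Q hQ
    obtain ⟨_, _⟩ := Set.mem_toFinset.1 hQ
    obtain ⟨σ, rfl⟩ := Ideal.exists_smul_eq_of_isGaloisGroup p P Q Gal(F/K)
    have h1 : differentBound K P M = differentBound K (σ • P) M := by
      simp_rw [differentBound, card_lowerGroup_smul]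
    rw [h1]
    exact pow_differentBound_dvd_differentIdeal _ (Ideal.ne_bot_of_liesOver_of_ne_bot hp _) M
end

/-! ### The Herbrand function and root discriminants -/

section

variable {K F : Type*} [Field K] [Field F] [Algebra K F]

theorem one_le_lowerCard [FiniteDimensional K F] (P : Ideal (𝓞 F)) (i : ℕ) :
    1 ≤ lowerCard K P i := by
  exact Nat.one_le_cast.2 Nat.card_pos

/-- The Herbrand function takes every positive value, so `herbrandPsi` is a genuine right inverse
there. -/
theorem exists_herbrandPhi_eq [FiniteDimensional K F] (P : Ideal (𝓞 F)) {y : ℝ} (hy : 0 < y) :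
    ∃ u ∈ Set.Ici (-1 : ℝ), herbrandPhi K P u = y := by
  have hg (i : ℕ) := one_le_lowerCard (K := K) P i
  have hg0 : 0 < lowerCard K P 0 := one_pos.trans_le (hg 0)
  let S (m : ℕ) : ℝ := ∑ i ∈ Finset.Icc 1 m, lowerCard K P i
  have hS (m : ℕ) : S (m + 1) = S m + lowerCard K P (m + 1) :=
    Finset.sum_Icc_succ_top (by omega) _
  have hSm (m : ℕ) : (m : ℝ) ≤ S m := by
    have := Finset.card_nsmul_le_sum (Finset.Icc 1 m) (fun i ↦ lowerCard K P i) 1 fun i _ ↦ hg i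
    simpa using this
  classical
  -- `y` lies between the values of the Herbrand function at the consecutive integers `m` and `m + 1`.
  have hex : ∃ m, y * lowerCard K P 0 < S (m + 1) := by
    obtain ⟨m, hm⟩ := exists_nat_gt (y * lowerCard K P 0)
    refine ⟨m, hm.trans_le ((hSm m).trans ?_)⟩
    linarith [hS m, hg (m + 1)]
  set m := Nat.find hex with hm
  have hlt : y * lowerCard K P 0 < S (m + 1) := Nat.find_spec hex
  have hle : S m ≤ y * lowerCard K P 0 := by
    rcases Nat.eq_zero_or_pos m with h | h
    · rw [h]
      simpa [S] using (mul_pos hy hg0).le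
    · have := Nat.find_min hex (show m - 1 < m by omega)
      rwa [not_lt, show m - 1 + 1 = m by omega] at this
  set t := (y * lowerCard K P 0 - S m) / lowerCard K P (m + 1) with ht
  have hgm : 0 < lowerCard K P (m + 1) := one_pos.trans_le (hg _)
  have ht0 : 0 ≤ t := div_nonneg (by linarith) hgm.le
  have ht1 : t < 1 := by
    rw [ht, div_lt_one hgm]
    linarith [hS m]
  have hfl : ⌊(m : ℝ) + t⌋₊ = m := by
    rw [Nat.floor_eq_iff (by positivity)]
    constructor <;> linarith
  have htg : t * lowerCard K P (m + 1) = y * lowerCard K P 0 - S m := div_mul_cancel₀ _ hgm.ne'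
  refine ⟨m + t, ?_, ?_⟩
  · rw [Set.mem_Ici]
    linarith [(Nat.cast_nonneg m : (0 : ℝ) ≤ m)]
  · have hpos : ¬ ((m : ℝ) + t ≤ 0) := by
      intro h
      have h1 : (m : ℝ) = 0 := le_antisymm (by linarith) (Nat.cast_nonneg m)
      have h2 : t = 0 := by linarith
      have h3 : m = 0 := by exact_mod_cast h1
      rw [h2, h3] at htg
      simp only [S, zero_mul, Finset.Icc_eq_empty_of_lt one_pos, Finset.sum_empty, sub_zero] at htg
      exact (mul_pos hy hg0).ne htg
    rw [herbrandPhi, if_neg hpos, hfl, add_sub_cancel_left, htg, div_eq_iff hg0.ne']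
    simp [S]

/-- If `D^y` is nontrivial, then with `u = ψ(y)` and `N = ⌈u⌉` all `g_i` with `i ≤ N` are at least
`2`, so `y g_0 = φ(u) g_0 ≤ g_1 + ⋯ + g_N ≤ 2 ∑_{i ≤ N} (g_i - 1)`. -/
theorem mul_lowerCard_zero_le [FiniteDimensional K F] (P : Ideal (𝓞 F)) {y : ℝ} (hy : 0 < y)
    (h : upperGroup K P y ≠ ⊥) :
    ∃ M : ℕ, y * lowerCard K P 0 ≤ 2 * differentBound K P M := by
  set u := herbrandPsi K P y
  have hu : herbrandPhi K P u = y := Function.invFunOn_eq (exists_herbrandPhi_eq P hy)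
  have hu0 : 0 < u := by
    by_contra! hle
    rw [herbrandPhi, if_pos hle] at hu
    linarith
  have hg0 : 0 < lowerCard K P 0 := one_pos.trans_le (one_le_lowerCard P 0)
  have hnt (i : ℕ) (hi : i ≤ ⌈u⌉₊) : 2 ≤ Nat.card (lowerGroup K P i) := by
    have hle : lowerGroup K P u ≤ lowerGroup K P i := by
      rw [lowerGroup_natCast, lowerGroup, Nat.ceil_add_one hu0.le]
      exact inf_le_inf_left _ fun σ hσ a ↦ Ideal.pow_le_pow_right (by omega) (hσ a)
    have : Nontrivial (lowerGroup K P i) :=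
      (Subgroup.nontrivial_iff_ne_bot _).2 fun hbot ↦ h (le_bot_iff.1 (hbot ▸ hle))
    exact Finite.one_lt_card
  refine ⟨⌈u⌉₊ + 1, ?_⟩
  have h1 : y * lowerCard K P 0 ≤ ∑ i ∈ Finset.Icc 1 ⌈u⌉₊, lowerCard K P i := by
    rw [← hu, herbrandPhi, if_neg hu0.not_ge, div_mul_cancel₀ _ hg0.ne']
    rcases (Nat.floor_le hu0.le).eq_or_lt with heq | hlt
    · have : ⌈u⌉₊ = ⌊u⌋₊ := by
        conv_lhs => rw [← heq, Nat.ceil_natCast]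
      rw [this, sub_eq_zero.2 heq.symm, zero_mul, add_zero]
    · have : ⌈u⌉₊ = ⌊u⌋₊ + 1 :=
        le_antisymm (Nat.ceil_le_floor_add_one u) (Nat.lt_ceil.2 hlt)
      rw [this, Finset.sum_Icc_succ_top (by omega)]
      have h2 := Nat.lt_floor_add_one u
      have h3 := one_le_lowerCard (K := K) P (⌊u⌋₊ + 1)
      have : (u - ⌊u⌋₊) * lowerCard K P (⌊u⌋₊ + 1) ≤ lowerCard K P (⌊u⌋₊ + 1) :=
        mul_le_of_le_one_left (by linarith) (by linarith)
      linarith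
  refine h1.trans ?_
  have h2 : ∑ i ∈ Finset.Icc 1 ⌈u⌉₊, lowerCard K P i
      = ((∑ i ∈ Finset.Icc 1 ⌈u⌉₊, Nat.card (lowerGroup K P i) : ℕ) : ℝ) := by
    rw [Nat.cast_sum]
    rfl
  rw [h2]
  norm_cast
  rw [differentBound, Finset.mul_sum]
  calc ∑ i ∈ Finset.Icc 1 ⌈u⌉₊, Nat.card (lowerGroup K P i)
      ≤ ∑ i ∈ Finset.Icc 1 ⌈u⌉₊, 2 * (Nat.card (lowerGroup K P i) - 1) := by
        refine Finset.sum_le_sum fun i hi ↦ ?_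
        have := hnt i (Finset.mem_Icc.1 hi).2
        omega
    _ ≤ _ := Finset.sum_le_sum_of_subset fun i hi ↦ by
        simp only [Finset.mem_Icc, Finset.mem_range] at hi ⊢
        omega

/-- A finite Galois extension of number fields with a nontrivial upper ramification group of index
`y` at `p` has root discriminant at least `N(p) ^ (y / (2 [K : ℚ]))`. -/
theorem le_log_rootDiscr [NumberField K] [NumberField F] [IsGalois K F]
    (p : Ideal (𝓞 K)) [p.IsPrime] (hp : p ≠ ⊥)
    (P : Ideal (𝓞 F)) [P.IsPrime] [P.LiesOver p] {y : ℝ} (hy : 0 < y)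
    (h : upperGroup K P y ≠ ⊥) :
    y * (Real.log (Ideal.absNorm p) / (2 * Module.finrank ℚ K)) ≤
      Real.log (NumberField.rootDiscr F) := by
  have : FiniteDimensional K F := Module.Finite.of_restrictScalars_finite ℚ K F
  obtain ⟨M, hM⟩ := mul_lowerCard_zero_le P hy h
  have hg0 : 0 < lowerCard K P 0 := one_pos.trans_le (one_le_lowerCard P 0)
  set D := (NumberField.discr F).natAbs with hD
  have hD0 : 0 < D := Int.natAbs_pos.2 (NumberField.discr_ne_zero F)
  have hN : Ideal.absNorm p ^ (Module.finrank K F * differentBound K P M)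
      ≤ D ^ Nat.card (lowerGroup K P 0) := by
    have h1 := map_dvd Ideal.absNorm (map_pow_dvd_differentIdeal_pow p hp P M)
    have hdvd : Ideal.absNorm (differentIdeal (𝓞 K) (𝓞 F)) ∣ D := by
      rw [hD, NumberField.natAbs_discr_eq_absNorm_differentIdeal_mul_natAbs_discr_pow
        K (𝓞 K) F (𝓞 F)]
      exact dvd_mul_right _ _
    rw [map_pow, map_pow, Ideal.absNorm_algebraMap,
      ← IsFractionRing.finrank_eq (𝓞 K) K (𝓞 F) F, ← pow_mul] at h1
    exact Nat.le_of_dvd (pow_pos hD0 _) (h1.trans (pow_dvd_pow_of_dvd hdvd _))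
  have hp1 : 0 < Ideal.absNorm p := Nat.pos_of_ne_zero (Ideal.absNorm_eq_zero_iff.not.2 hp)
  have hlogp : 0 ≤ Real.log (Ideal.absNorm p) := Real.log_natCast_nonneg _
  have hlog : (Module.finrank K F * differentBound K P M : ℝ) * Real.log (Ideal.absNorm p)
      ≤ lowerCard K P 0 * Real.log D := by
    have h1 : ((Ideal.absNorm p : ℝ)) ^ (Module.finrank K F * differentBound K P M)
        ≤ (D : ℝ) ^ Nat.card (lowerGroup K P 0) := by exact_mod_cast hN
    have h2 := Real.log_le_log (by positivity) h1
    rw [Real.log_pow, Real.log_pow] at h2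
    simpa [lowerCard] using h2
  have hfin : (Module.finrank ℚ F : ℝ) = Module.finrank ℚ K * Module.finrank K F := by
    exact_mod_cast (Module.finrank_mul_finrank ℚ K F).symm
  have hK : (0 : ℝ) < Module.finrank ℚ K := by exact_mod_cast Module.finrank_pos
  have hF : (0 : ℝ) < Module.finrank K F := by exact_mod_cast Module.finrank_pos
  have hdisc : (|NumberField.discr F| : ℤ) = (D : ℝ) := by
    rw [hD, Int.abs_eq_natAbs, Int.cast_natCast]
  have hmain : y * Module.finrank K F * Real.log (Ideal.absNorm p) ≤ 2 * Real.log D := by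
    refine le_of_mul_le_mul_left ?_ hg0
    have h1 := mul_le_mul_of_nonneg_right hM (mul_nonneg hF.le hlogp)
    linarith
  rw [NumberField.rootDiscr_def, hdisc, Real.log_rpow (by exact_mod_cast hD0), hfin,
    ← mul_div_assoc, inv_mul_eq_div, div_le_div_iff₀ (by positivity) (by positivity)]
  nlinarith [mul_le_mul_of_nonneg_left hmain hK.le]

end

/-- An element `σ ≠ 1` of `D^y(L/K)` moves some `x`, and restricts to a nontrivial element of
`D^y(F/K)` for the Galois closure `F` of `K(x)`. -/
theorem exists_upperGroup_ne_bot {K L : Type*} [Field K] [Field L] [Algebra K L] [IsGalois K L]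
    {P : Ideal (𝓞 L)} {y : ℝ} (h : profiniteUpperGroup K P y ≠ ⊥) :
    ∃ F : FiniteGaloisIntermediateField K L, upperGroup K (P.under (𝓞 F)) y ≠ ⊥ := by
  obtain ⟨⟨σ, hσ⟩, hσ1⟩ := Subgroup.ne_bot_iff_exists_ne_one.1 h
  obtain ⟨x, hx⟩ : ∃ x, σ x ≠ x := by
    by_contra! hcon
    exact hσ1 (Subtype.ext (AlgEquiv.ext hcon))
  refine ⟨FiniteGaloisIntermediateField.adjoin K {x}, fun hbot ↦ hx ?_⟩
  have h1 := Subgroup.mem_iInf.1 hσ (FiniteGaloisIntermediateField.adjoin K {x})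
  rw [hbot, Subgroup.mem_comap, Subgroup.mem_bot] at h1
  have hxF := FiniteGaloisIntermediateField.subset_adjoin K {x} (Set.mem_singleton x)
  have h2 := AlgEquiv.restrictNormal_commutes σ (FiniteGaloisIntermediateField.adjoin K {x})
    ⟨x, hxF⟩
  exact h2.symm.trans (congrArg _ (DFunLike.congr_fun h1 _))

end HigherRamification

theorem theorem4p4 (K L : Type*) [Field K] [NumberField K] [Field L] [Algebra K L] [IsGalois K L]
    (p : Ideal (𝓞 K)) (hp : p.IsPrime) (hp0 : p ≠ ⊥)
    (h : HigherRamification.IsDeeplyRamifiedAt K L p) :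
    HigherRamification.IsAsymptoticallyBad K L := by
  obtain ⟨P, hP, hPp, hram⟩ := h
  -- The index `n + 1` is used at stage `n` because the estimates need a positive index.
  have hpos (n : ℕ) : (0 : ℝ) < n + 1 := n.cast_add_one_pos
  choose F hF using fun n : ℕ ↦ HigherRamification.exists_upperGroup_ne_bot
    (hram (n + 1) (by linarith [hpos n]))
  refine ⟨fun n ↦ (F n).toIntermediateField, fun n ↦ (F n).finiteDimensional, ?_⟩
  have hc : 0 < Real.log (Ideal.absNorm p) / (2 * Module.finrank ℚ K) := by
    have h1 : Ideal.absNorm p ≠ 0 := Ideal.absNorm_eq_zero_iff.not.2 hp0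
    have h2 : Ideal.absNorm p ≠ 1 := Ideal.absNorm_eq_one_iff.not.2 hp.ne_top
    have h3 : 0 < Module.finrank ℚ K := Module.finrank_pos
    have : 0 < Real.log (Ideal.absNorm p) := Real.log_pos (by exact_mod_cast (by omega))
    positivity
  refine tendsto_atTop_mono (fun n ↦ ?_) (tendsto_natCast_atTop_atTop.atTop_mul_const hc)
  have := NumberField.of_module_finite K (F n)
  have : (P.under (𝓞 (F n))).LiesOver p := ⟨by rw [Ideal.under_under, hPp.over]⟩
  have := HigherRamification.le_log_rootDiscr p hp0 (P.under (𝓞 (F n))) (hpos n) (hF n)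
  have h2 := Real.log_le_self (x := NumberField.rootDiscr (F n))
    (by rw [NumberField.rootDiscr_def]; positivity)
  nlinarith
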